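/- For a positive integer $r$, an exact $r$-coloring of $\mathbb{Z}_n$ (the integers modulo $n$) is a surjective map $c:\mathbb{Z}_n\to\{1,\dots,r\}$. A $3$-term arithmetic progression in $\mathbb{Z}_n$ consists of three distinct elements of the form $a,\ a+d,\ a+2d$ with $a,d\in\mathbb{Z}_n$; it is rainbow under $c$ if its three terms receive three distinct colors. Let $\operatorname{aw}(\mathbb{Z}_n,3)$ denote the smallest positive integer $r$ such that every exact $r$-coloring of $\mathbb{Z}_n$ contains a rainbow $3$-term arithmetic progression. If $p$ is a prime and $p\equiv 1\pmod 8$, then $\operatorname{aw}(\mathbb{Z}_p,3)=4$. There are infinitely many primes $p\equiv 1\pmod 8$; hence there are infinitely many primes $p$ with $\operatorname{aw}(\mathbb{Z}_p,3)=4$. -/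

import Mathlib

/-- `t` is a `k`-term arithmetic progression in `S`: its terms are distinct elements of `S` of the
form `a, a + d, a + 2d, …, a + (k-1)d`. Distinctness is required explicitly, so `d ≠ 0` for
`k ≥ 2`. -/
def IsKTermAP {G : Type*} [AddCommGroup G] (S : Set G) (k : ℕ) (t : Fin k → S) : Prop :=
  Function.Injective t ∧ ∃ a d : G, ∀ i : Fin k, (t i : G) = a + (i : ℕ) • d

/-- The coloring `c` of `S` has a rainbow `k`-term arithmetic progression: one whose `k` terms
receive `k` distinct colors. -/
def HasRainbowAP {G : Type*} [AddCommGroup G] (S : Set G) (k : ℕ) {r : ℕ} (c : S → Fin r) : Prop :=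
  ∃ t : Fin k → S, IsKTermAP S k t ∧ Function.Injective (fun i => c (t i))

/-- The anti-van der Waerden number of a finite set `S`: the smallest positive integer `r` such that
every exact (that is, surjective) `r`-coloring of `S` has a rainbow `k`-term arithmetic
progression. The number of colors must be positive, since a nonempty set has no
`0`-coloring at all; `r = |S| + 1` always qualifies, so the minimum exists. -/
noncomputable def antiVdW {G : Type*} [AddCommGroup G] (S : Set G) (k : ℕ) : ℕ :=
  sInf {r : ℕ | 1 ≤ r ∧ ∀ c : S → Fin r, Function.Surjective c → HasRainbowAP S k c}

/-! Upper bound: in a rainbow-free coloring each step `d` has a dominant color, present in every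
bichromatic pair `u, u + d` (`RainbowFree.exists_dominant`). Let `P i` collect the nonzero steps
assigned to color `i`. Adding `{0} ∪ P i` to another class reaches only that class and class `i`, so
Cauchy–Davenport gives `#(P i) ≤ #(cls i)`. Summed over four colors these bounds lose only 1, so
some `P a` is tight. With `S` the union of two other classes, `S` and `{0} ∪ P a` form a critical
pair, and Vosper's theorem (`exists_card_add_pair_le`) gives a step that leaves `S` only once; no
dominant color allows this. Lower bound: -1 and 2 are squares, so the coloring by zero, square,
nonsquare is rainbow-free; merging its colors settles fewer than three. -/

/-- No three terms `a, a + d, a + 2d` of `G` receive three distinct colors under `f`. -/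
def RainbowFree {G K : Type*} [AddCommGroup G] (f : G → K) : Prop :=
  ∀ a d : G, f a = f (a + d) ∨ f (a + d) = f (a + d + d) ∨ f a = f (a + d + d)

/-! ### Dominant colors -/

/-- The color `X` occurs in every bichromatic pair of the form `u, u + 1` in `[s, s + m]`. -/
def IsDominantOn {K : Type*} (f : ℤ → K) (s : ℤ) (m : ℕ) (X : K) : Prop :=
  ∀ u, s ≤ u → u < s + m → f u = f (u + 1) ∨ f u = X ∨ f (u + 1) = X

lemma RainbowFree.of_midpoint {K : Type*} {f : ℤ → K} (hf : RainbowFree f) {a b c : ℤ}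
    (h : a + c = 2 * b) : f a = f b ∨ f b = f c ∨ f a = f c := by
  have := hf a (b - a)
  rwa [show a + (b - a) + (b - a) = c by linarith, show a + (b - a) = b by ring] at this

/-- An interval carrying only the colors `X` and `Z`, starting with `X` and ending with `Z`, cannot
be bordered on both sides by other colors. -/
lemma RainbowFree.false_of_two_colored_gap {K : Type*} {f : ℤ → K} (hf : RainbowFree f) {n : ℤ}
    {X Z : K} (hXZ : X ≠ Z) (h0X : f 0 ≠ X) (h0Z : f 0 ≠ Z) (hnX : f n ≠ X) (hnZ : f n ≠ Z)
    (hn : 2 ≤ n) (hmem : ∀ i, 0 < i → i < n → f i = X ∨ f i = Z) (h1 : f 1 = X)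
    (hl : f (n - 1) = Z) : False := by
  have hn3 : 3 ≤ n := by
    by_contra h
    obtain rfl : n = 2 := by omega
    norm_num at hl
    exact hXZ (h1.symm.trans hl)
  have hout : ∀ i, 0 < i → i < n → f i ≠ f 0 ∧ f i ≠ f n := fun i h h' => by
    rcases hmem i h h' with e | e <;> rw [e] <;> exact ⟨Ne.symm ‹_›, Ne.symm ‹_›⟩
  have hdbl : ∀ i, 0 < i → 2 * i < n → f (2 * i) = f i := fun i h h' => by
    have h2 := hout i h (by omega)
    have h3 := hout (2 * i) (by omega) h'
    rcases hf.of_midpoint (a := 0) (b := i) (c := 2 * i) (by ring) with e | e | e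
    exacts [(h2.1 e.symm).elim, e.symm, (h3.1 e.symm).elim]
  have hn2 : f (n - 2) = Z := by
    have h2 := hout (n - 1) (by omega) (by omega)
    have h3 := hout (n - 2) (by omega) (by omega)
    rcases hf.of_midpoint (a := n) (b := n - 1) (c := n - 2) (by ring) with e | e | e
    exacts [(h2.2 e.symm).elim, e.symm.trans hl, (h3.2 e.symm).elim]
  have h2X : f 2 = X := (hdbl 1 (by norm_num) (by omega)).trans h1
  rcases Int.even_or_odd' n with ⟨m, rfl | rfl⟩
  · have hm : f (m - 1) = Z := by
      rw [← hn2, ← hdbl (m - 1) (by omega) (by omega)]; congr 1; ring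
    have hY : f (2 * m) = f 0 := by
      have h2 := hout m (by omega) (by omega)
      rcases hf.of_midpoint (a := 0) (b := m) (c := 2 * m) (by ring) with e | e | e
      exacts [(h2.1 e.symm).elim, (h2.2 e).elim, e.symm]
    -- The two progressions restrict `f (-2)` to `{f 0, X}` and to `{f 0, Z}`. Then `-2, i, 2 * (i +
    -- 1)` and doubling force `f (i + 1) = f i`.
    have hneg : f (-2) = f 0 := by
      have e1 := hf.of_midpoint (a := -2) (b := 0) (c := 2) (by ring)
      have e2 := hf.of_midpoint (a := -2) (b := m - 1) (c := 2 * m) (by ring)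
      rw [h2X] at e1
      rw [hm, hY] at e2
      grind
    have hshift : ∀ i, 0 < i → i + 1 < m → f (i + 1) = f i := fun i h h' => by
      rw [← hdbl (i + 1) (by omega) (by omega)]
      have h2 := hout i h (by omega)
      have h3 := hout (2 * (i + 1)) (by omega) (by omega)
      have := hf.of_midpoint (a := -2) (b := i) (c := 2 * (i + 1)) (by ring)
      grind
    have hall : ∀ k : ℕ, (k : ℤ) + 1 < m → f (k + 1) = X := by
      intro k
      induction k with
      | zero => intro _; simpa using h1
      | succ k ih =>
        intro h
        push_cast at h ⊢
        rw [hshift _ (by omega) (by omega), ih (by omega)]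
    have := hall (m - 2).toNat (by omega)
    rw [show (((m - 2).toNat : ℕ) : ℤ) + 1 = m - 1 by omega] at this
    exact hXZ (this.symm.trans hm)
  · have hm : f m = Z := by
      rw [← hdbl m (by omega) (by omega), ← hl]; congr 1; ring
    -- Now -1 plays the role of -2: the progression `-1, j, 2 * j + 1` gives `f (2 * j + 1) = f j`.
    have hneg : f (-1) = f 0 := by
      have e1 := hf.of_midpoint (a := -1) (b := 0) (c := 1) (by ring)
      have e2 := hf.of_midpoint (a := -1) (b := m) (c := 2 * m + 1) (by ring)
      rw [h1] at e1
      rw [hm] at e2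
      grind
    have hall : ∀ k : ℕ, 0 < k → (k : ℤ) < 2 * m + 1 → f k = X := by
      intro k
      induction k using Nat.strong_induction_on with
      | _ k ih =>
        intro hk hk'
        rcases Nat.even_or_odd' k with ⟨j, rfl | rfl⟩
        · push_cast at hk' ⊢
          rw [hdbl j (by omega) (by omega)]
          exact ih j (by omega) (by omega) (by omega)
        · rcases Nat.eq_zero_or_pos j with rfl | hj
          · simpa using h1
          · push_cast at hk' ⊢
            rw [← ih j (by omega) hj (by omega)]
            have h2 := hout j (by omega) (by omega)
            have h3 := hout (2 * j + 1) (by omega) hk'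
            have := hf.of_midpoint (a := -1) (b := j) (c := 2 * j + 1) (by ring)
            grind
    have := hall m.toNat (by omega) (by omega)
    rw [show ((m.toNat : ℕ) : ℤ) = m by omega] at this
    exact hXZ (this.symm.trans hm)

lemma RainbowFree.comp_add_left {K : Type*} {f : ℤ → K} (hf : RainbowFree f) (s : ℤ) :
    RainbowFree (fun i => f (s + i)) := fun a d => by
  simpa only [add_assoc] using hf (s + a) d

/-- Let `X`, `Z` be dominant on the two subintervals missing one endpoint. On their overlap every
color change is between `X` and `Z`. So the overlap is constant, and its color dominates, or it is
the gap already excluded. -/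
lemma RainbowFree.exists_isDominantOn {K : Type*} {f : ℤ → K} (hf : RainbowFree f) (m : ℕ) :
    ∀ s, ∃ X, IsDominantOn f s m X := by
  induction m with
  | zero => exact fun s => ⟨f s, fun u h h' => by simp at h'; omega⟩
  | succ m ih =>
    intro s
    by_contra! hno
    obtain ⟨X, hX⟩ := ih s
    obtain ⟨Z, hZ⟩ := ih (s + 1)
    have hlast : f (s + m) ≠ f (s + m + 1) ∧ f (s + m) ≠ X ∧ f (s + m + 1) ≠ X := by
      by_contra hcon
      refine hno X fun u hu hu' => ?_
      rcases eq_or_ne u (s + m) with rfl | hne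
      · tauto
      · exact hX u hu (by push_cast at hu'; omega)
    have hfirst : f s ≠ f (s + 1) ∧ f s ≠ Z ∧ f (s + 1) ≠ Z := by
      by_contra hcon
      refine hno Z fun u hu hu' => ?_
      rcases eq_or_ne u s with rfl | hne
      · tauto
      · exact hZ u (by omega) (by push_cast at hu'; omega)
    have hm : 0 < m := by
      by_contra h
      obtain rfl : m = 0 := by omega
      exact hno (f s) fun u hu hu' => by
        obtain rfl : u = s := by simp at hu'; omega
        simp
    have hXs := hX s le_rfl (by omega)
    have hZl := hZ (s + m) (by omega) (by omega)
    by_cases h1 : f (s + 1) = X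
    · have hXZ : X ≠ Z := by rintro rfl; exact hfirst.2.2 h1
      have hmem : ∀ k : ℕ, k + 1 ≤ m → f (s + (k + 1)) = X ∨ f (s + (k + 1)) = Z := by
        intro k
        induction k with
        | zero => intro _; simp [h1]
        | succ k ihk =>
          intro hk
          have e1 := hX (s + (k + 1)) (by omega) (by omega)
          have e2 := hZ (s + (k + 1)) (by omega) (by omega)
          have e3 := ihk (by omega)
          rw [show s + ((k : ℤ) + 1) + 1 = s + (k + 1 + 1) by ring] at e1 e2
          push_cast
          grind
      have hmZ : f (s + m) = Z := by
        have := hmem (m - 1) (by omega)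
        rw [show ((m - 1 : ℕ) : ℤ) + 1 = m by omega] at this
        tauto
      refine (hf.comp_add_left s).false_of_two_colored_gap (n := m + 1) hXZ ?_ ?_ ?_ ?_ ?_ ?_ ?_ ?_
      · simpa using fun h => hfirst.1 (h.trans h1.symm)
      · simpa using hfirst.2.1
      · simpa [← add_assoc] using hlast.2.2
      · simpa [← add_assoc] using fun h => hlast.1 (hmZ.trans h.symm)
      · omega
      · intro i hi hi'
        have := hmem (i - 1).toNat (by omega)
        rwa [show (((i - 1).toNat : ℕ) : ℤ) + 1 = i by omega] at this
      · exact h1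
      · simpa using hmZ
    · have hall : ∀ k : ℕ, k + 1 ≤ m → f (s + (k + 1)) = f (s + 1) := by
        intro k
        induction k with
        | zero => intro _; simp
        | succ k ihk =>
          intro hk
          have e1 := hX (s + (k + 1)) (by omega) (by omega)
          have e2 := hZ (s + (k + 1)) (by omega) (by omega)
          have e3 := ihk (by omega)
          rw [show s + ((k : ℤ) + 1) + 1 = s + (k + 1 + 1) by ring] at e1 e2
          push_cast
          grind
      refine hno (f (s + 1)) fun u hu hu' => ?_
      push_cast at hu'
      rcases eq_or_ne u s with rfl | hne
      · simp
      · have := hall (u - s - 1).toNat (by omega)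
        rw [show s + ((((u - s - 1).toNat : ℕ) : ℤ) + 1) = u by omega] at this
        exact Or.inr (Or.inl this)

/-- For each common difference, a rainbow-free coloring of `ZMod p` has a dominant color. -/
theorem RainbowFree.exists_dominant {p : ℕ} [Fact p.Prime] {K : Type*} {c : ZMod p → K}
    (hc : RainbowFree c) {d : ZMod p} (hd : d ≠ 0) :
    ∃ X, ∀ u, c u = c (u + d) ∨ c u = X ∨ c (u + d) = X := by
  have hf : RainbowFree (fun i : ℤ => c (i * d)) := fun a e => by
    simpa only [Int.cast_add, add_mul] using hc (a * d) (e * d)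
  obtain ⟨X, hX⟩ := hf.exists_isDominantOn p 0
  refine ⟨X, fun u => ?_⟩
  have := hX (u / d).val (by positivity) (by
    rw [zero_add]; exact_mod_cast ZMod.val_lt (u / d))
  simpa [add_mul, hd] using this

/-! ### Fragments and Vosper's theorem -/

open scoped Pointwise in
/-- `F` is a set of at least two elements whose sum with `S` is as small as the Cauchy–Davenport
inequality allows, and which is not too large. -/
def IsFragment {p : ℕ} (S F : Finset (ZMod p)) : Prop :=
  2 ≤ F.card ∧ F.card + S.card < p ∧ (F + S).card < F.card + S.card

section Vosper
open Finset
open scoped Pointwise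
variable {p : ℕ} [Fact p.Prime]

lemma IsFragment.symm {S F : Finset (ZMod p)} (h : IsFragment S F) (hS : 2 ≤ #S) :
    IsFragment F S :=
  ⟨hS, by rw [add_comm]; exact h.2.1, by rw [add_comm, add_comm #S]; exact h.2.2⟩

lemma IsFragment.neg_compl {S F : Finset (ZMod p)} (h : IsFragment S F) (hS : S.Nonempty) :
    IsFragment S (-(F + S)ᶜ) ∧ #(-(F + S)ᶜ) + #F + #S = p + 1 := by
  obtain ⟨h2, hlt, hc⟩ := h
  have hcd := ZMod.cauchy_davenport (Fact.out : p.Prime) (card_pos.1 (by omega : 0 < #F)) hS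
  have hSpos := hS.card_pos
  have hcard : #(-(F + S)ᶜ) = p - #(F + S) := by
    rw [card_neg, card_compl, ZMod.card]
  have hle : #(-(F + S)ᶜ + S) ≤ p - #F := by
    have hFc : #Fᶜ = p - #F := by rw [card_compl, ZMod.card]
    rw [← card_neg (-(F + S)ᶜ + S), ← hFc]
    refine card_le_card fun x hx => ?_
    rw [mem_neg] at hx
    obtain ⟨y, hy, rfl⟩ := hx
    obtain ⟨u, hu, s, hs, rfl⟩ := mem_add.1 hy
    rw [mem_neg] at hu
    obtain ⟨v, hv, rfl⟩ := hu
    rw [mem_compl] at hv ⊢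
    exact fun hF => hv (mem_add.2 ⟨_, hF, s, hs, by ring⟩)
  have hle' : #(F + S) ≤ p := (card_le_univ _).trans_eq (ZMod.card p)
  refine ⟨⟨?_, ?_, ?_⟩, ?_⟩ <;> omega

lemma eq_zero_of_add_pair_subset {F : Finset (ZMod p)} (hF : F.Nonempty) (hlt : #F < p)
    {t : ZMod p} (h : F + {0, t} ⊆ F) : t = 0 := by
  by_contra ht
  have hcd := ZMod.cauchy_davenport (Fact.out : p.Prime) hF (insert_nonempty 0 {t})
  rw [card_pair (Ne.symm ht)] at hcd
  have := card_le_card h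
  omega

/-- Submodularity: a larger intersection would itself be a fragment, hence all of `F`, making `F`
periodic. Comparing `F` with its dual `-(F + S)ᶜ` keeps the union small enough that Cauchy–Davenport
does not saturate at `p`. -/
lemma card_inter_translate_le_one {S F : Finset (ZMod p)} (hS : S.Nonempty) (hF : IsFragment S F)
    (hmin : ∀ G, IsFragment S G → #F ≤ #G) {t : ZMod p} (ht : t ≠ 0) :
    #(F ∩ (F + {t})) ≤ 1 := by
  by_contra! h2
  obtain ⟨hfr, hsum⟩ := hF.neg_compl hS
  have hle := hmin _ hfr
  obtain ⟨hF2, hlt, hc⟩ := hF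
  have hFne : F.Nonempty := card_pos.1 (by omega)
  have hSpos := hS.card_pos
  have hcardt : #(F + {t}) = #F := by simp
  have hui := card_union_add_card_inter F (F + {t})
  have hcd := ZMod.cauchy_davenport (Fact.out : p.Prime)
    (hFne.mono (subset_union_left (s₂ := F + {t}))) hS
  have hct : #(F + {t} + S) = #(F + S) := by
    rw [add_right_comm]; simp
  have hui' := card_union_add_card_inter (F + S) (F + {t} + S)
  rw [← union_add] at hui'
  have hsub := card_le_card (inter_add_subset (s₁ := F) (s₂ := F + {t}) (t := S))
  have hi : #(F ∩ (F + {t})) ≤ #F := card_le_card inter_subset_left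
  have hfrag : IsFragment S (F ∩ (F + {t})) := ⟨h2, by omega, by omega⟩
  have heq : F ∩ (F + {t}) = F := eq_of_subset_of_card_le inter_subset_left (hmin _ hfrag)
  have hFt : F + {t} = F :=
    (eq_of_subset_of_card_le (inter_eq_left.1 heq) hcardt.le).symm
  refine ht (eq_zero_of_add_pair_subset hFne (by omega) (t := t) ?_)
  rw [insert_eq, add_union, hFt, singleton_zero, add_zero, union_self]

/-- A new translate of `F` meets each earlier one at most once, so it adds at least `#F - #K`
elements. -/
lemma card_add_le_card_add {F : Finset (ZMod p)} (h3 : 3 ≤ #F)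
    (hF : ∀ t : ZMod p, t ≠ 0 → #(F ∩ (F + {t})) ≤ 1) (K : Finset (ZMod p)) :
    2 ≤ #K → #K ≤ #F → #F + #K ≤ #(F + K) := by
  induction K using Finset.induction_on with
  | empty => simp
  | insert k K hk ih =>
    rw [card_insert_of_notMem hk]
    intro h2 hle
    have hinter : #((F + {k}) ∩ (F + K)) ≤ #K := by
      have hsub : (F + {k}) ∩ (F + K) ⊆ K.biUnion fun l => (F + {k}) ∩ (F + {l}) := by
        intro x hx
        obtain ⟨hx1, hx2⟩ := mem_inter.1 hx
        obtain ⟨u, hu, l, hl, rfl⟩ := mem_add.1 hx2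
        exact mem_biUnion.2 ⟨l, hl, mem_inter.2 ⟨hx1, add_mem_add hu (mem_singleton_self l)⟩⟩
      refine (card_le_card hsub).trans ((card_biUnion_le_card_mul _ _ 1 fun l hl => ?_).trans_eq
        (mul_one _))
      have hne : l - k ≠ 0 := sub_ne_zero.2 (by rintro rfl; exact hk hl)
      have : (F + {k}) ∩ (F + {l}) = (F ∩ (F + {l - k})) + {k} := by
        rw [inter_add_singleton, add_assoc, singleton_add_singleton, sub_add_cancel]
      rw [this, card_add_singleton]
      exact hF _ hne
    have hui := card_union_add_card_inter (F + {k}) (F + K)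
    rw [← add_union, ← insert_eq, card_add_singleton] at hui
    by_cases h : 2 ≤ #K
    · have := ih h (by omega)
      omega
    · obtain ⟨l, rfl⟩ := card_eq_one.1 (by omega : #K = 1)
      rw [card_add_singleton] at hui
      rw [card_singleton] at *
      omega

lemma exists_minimal_fragment {S F : Finset (ZMod p)} (h : IsFragment S F) :
    ∃ H, IsFragment S H ∧ ∀ G, IsFragment S G → #H ≤ #G := by
  classical
  obtain ⟨H, hH, hmin⟩ := exists_min_image (univ.filter fun G => IsFragment S G) card
    ⟨F, by simpa using h⟩
  exact ⟨H, by simpa using hH, fun G hG => hmin G (by simpa using hG)⟩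

/-- The part of Vosper's theorem that is needed: one summand of a critical pair is an arithmetic
progression. -/
theorem exists_card_add_pair_le {S Q : Finset (ZMod p)} (hS : 2 ≤ #S) (hQ : IsFragment S Q) :
    ∃ d : ZMod p, d ≠ 0 ∧ #(S + {0, d}) ≤ #S + 1 := by
  obtain ⟨H, hH, hHmin⟩ := exists_minimal_fragment hQ
  have hSne : S.Nonempty := card_pos.1 (by omega)
  have hHne : H.Nonempty := card_pos.1 (by have := hH.1; omega)
  -- Criticality is symmetric, so `S` is a fragment of `H`. Both `H` and `K` overlap their
  -- translates little, so the larger serves as `F` in `card_add_le_card_add`.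
  obtain ⟨K, hK, hKmin⟩ := exists_minimal_fragment (hH.symm hS)
  have hH2 : #H = 2 := by
    by_contra hne
    have h3 : 3 ≤ #H := by have := hH.1; omega
    have hlt := hK.2.2
    rcases le_total #K #H with hle | hle
    · have := card_add_le_card_add h3
        (fun t => card_inter_translate_le_one hSne hH hHmin) K hK.1 hle
      rw [add_comm K] at hlt
      omega
    · have := card_add_le_card_add (h3.trans hle)
        (fun t => card_inter_translate_le_one hHne hK hKmin) H (by omega) hle
      omega
  obtain ⟨x, y, hxy, rfl⟩ := card_eq_two.1 hH2
  refine ⟨y - x, sub_ne_zero.2 hxy.symm, ?_⟩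
  have : ({x, y} : Finset (ZMod p)) + S = S + {0, y - x} + {x} := by
    rw [add_assoc, add_comm S]
    congr 1
    rw [insert_eq 0, union_add, singleton_add_singleton, singleton_add_singleton, zero_add,
      sub_add_cancel, ← insert_eq]
  have hlt := hH.2.2
  rw [this, card_add_singleton, hH2] at hlt
  omega

end Vosper

/-! ### Four colors force a rainbow progression -/

section FourColors
open Finset
open scoped Pointwise
variable {p : ℕ} [Fact p.Prime]

lemma exists_mem_add_notMem {S : Finset (ZMod p)} (hS : S.Nonempty) (hlt : #S < p) {d : ZMod p}
    (hd : d ≠ 0) : ∃ u ∈ S, u + d ∉ S := by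
  by_contra! h
  refine hd (eq_zero_of_add_pair_subset hS hlt (t := d) fun x hx => ?_)
  obtain ⟨u, hu, v, hv, rfl⟩ := mem_add.1 hx
  rcases mem_insert.1 hv with rfl | hv
  · simpa using hu
  · rw [mem_singleton.1 hv]
    exact h u hu

lemma eq_of_card_add_pair_le {S : Finset (ZMod p)} {d : ZMod p} (h : #(S + {0, d}) ≤ #S + 1)
    {u v : ZMod p} (hu : u ∈ S) (hv : v ∈ S) (hu' : u + d ∉ S) (hv' : v + d ∉ S) : u = v := by
  by_contra hne
  have hsub : insert (u + d) (insert (v + d) S) ⊆ S + {0, d} := by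
    intro x hx
    rcases mem_insert.1 hx with rfl | hx
    · exact add_mem_add hu (by simp)
    rcases mem_insert.1 hx with rfl | hx
    · exact add_mem_add hv (by simp)
    · exact mem_add.2 ⟨x, hx, 0, by simp, by simp⟩
  have := card_le_card hsub
  rw [card_insert_of_notMem (by simp [hne, hu']), card_insert_of_notMem hv'] at this
  omega

/-- A coloring of `ZMod p` with exactly four colors has a rainbow progression. -/
theorem not_rainbowFree_of_surjective_four {c : ZMod p → Fin 4} (hs : Function.Surjective c)
    (hp : 4 < p) : ¬ RainbowFree c := by
  intro hc
  choose! X hX using fun (d : ZMod p) (hd : d ≠ 0) => hc.exists_dominant hd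
  set cls : Fin 4 → Finset (ZMod p) := fun i => univ.filter fun u => c u = i with hcls
  set P : Fin 4 → Finset (ZMod p) := fun i => (univ.erase 0).filter fun d => X d = i with hPdef
  have huniv : #(univ : Finset (ZMod p)) = p := by rw [card_univ, ZMod.card]
  have hcompl : ∀ T : Finset (ZMod p), #Tᶜ + #T = p := fun T => by
    rw [card_compl_add_card, ZMod.card]
  have hsum : ∑ i, #(cls i) = p :=
    (card_eq_sum_card_fiberwise (f := c) (by simp)).symm.trans huniv
  have hsumP : ∑ i, #(P i) = p - 1 := by
    rw [← card_eq_sum_card_fiberwise (f := X) (s := univ.erase 0) (t := univ) (by simp),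
      card_erase_of_mem (mem_univ _), huniv]
  have hpos : ∀ i, 0 < #(cls i) := fun i => by
    obtain ⟨u, hu⟩ := hs i
    exact card_pos.2 ⟨u, by simp [hcls, hu]⟩
  have hP : ∀ {i d}, d ∈ insert 0 (P i) → ∀ u, c u = c (u + d) ∨ c u = i ∨ c (u + d) = i := by
    intro i d hd u
    rcases mem_insert.1 hd with rfl | hd
    · simp
    · simp only [hPdef, mem_filter, mem_erase] at hd
      rw [← hd.2]
      exact hX d hd.1.1 u
  have hcardQ : ∀ i, #(insert 0 (P i)) = #(P i) + 1 := fun i =>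
    card_insert_of_notMem (by simp [hPdef])
  have hpr : p.Prime := Fact.out
  have hlt2 : ∀ i j, i ≠ j → #(cls i) + #(cls j) < p := by
    intro i j hij
    have h0 := hpos 0
    have h1 := hpos 1
    have h2 := hpos 2
    have h3 := hpos 3
    rw [Fin.sum_univ_four] at hsum
    fin_cases i <;> fin_cases j <;> simp at hij ⊢ <;> omega
  have hPle : ∀ i, #(P i) ≤ #(cls i) := by
    intro i
    obtain ⟨j, hj⟩ := exists_ne i
    have hsub : cls j + insert 0 (P i) ⊆ cls i ∪ cls j := by
      intro x hx
      obtain ⟨u, hu, d, hd, rfl⟩ := mem_add.1 hx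
      have := hP hd u
      simp only [hcls, mem_filter, mem_univ, true_and, mem_union] at hu ⊢
      grind
    have h1 := (card_le_card hsub).trans (card_union_le _ _)
    have h2 := ZMod.cauchy_davenport hpr (card_pos.1 (hpos j)) (insert_nonempty 0 (P i))
    have h3 := hlt2 i j hj.symm
    rw [hcardQ] at h2
    omega
  -- Two elements in class `b` keep `#S + #(P a) + 1` below `p`, as a fragment requires.
  obtain ⟨b, hb⟩ : ∃ b, 2 ≤ #(cls b) := by
    by_contra! h
    have : ∑ i, #(cls i) ≤ ∑ _i : Fin 4, 1 := sum_le_sum fun i _ => Nat.lt_succ_iff.1 (h i)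
    simp at this
    omega
  obtain ⟨a, hab, ha⟩ : ∃ a, a ≠ b ∧ #(cls a) ≤ #(P a) := by
    by_contra! h
    rw [Fin.sum_univ_four] at hsum hsumP
    have h0 := h 0
    have h1 := h 1
    have h2 := h 2
    have h3 := h 3
    have hb' := hPle b
    fin_cases b <;> simp at h0 h1 h2 h3 hb' <;> omega
  obtain ⟨e, f, hef, hea, heb, hfa, hfb⟩ :
      ∃ e f : Fin 4, e ≠ f ∧ e ≠ a ∧ e ≠ b ∧ f ≠ a ∧ f ≠ b := by
    clear * - hab
    revert a b; decide
  set S : Finset (ZMod p) := univ.filter fun u => c u ≠ a ∧ c u ≠ b with hSdef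
  have hScard : #S + (#(cls a) + #(cls b)) = p := by
    have hu : Disjoint (cls a) (cls b) := by
      rw [disjoint_left]; intro x; simp only [hcls, mem_filter]; grind
    have hSc : S = (cls a ∪ cls b)ᶜ := by ext x; simp [hcls, hSdef]
    rw [← card_union_of_disjoint hu, hSc, hcompl]
  have hS2 : 2 ≤ #S := by
    obtain ⟨u, hu⟩ := hs e
    obtain ⟨v, hv⟩ := hs f
    have : ({u, v} : Finset (ZMod p)) ⊆ S := by
      intro x hx
      rcases mem_insert.1 hx with rfl | hx
      · simp [hSdef, hu, hea, heb]
      · rw [mem_singleton.1 hx]; simp [hSdef, hv, hfa, hfb]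
    rw [← card_pair (a := u) (b := v) (by rintro rfl; exact hef (hu.symm.trans hv))]
    exact card_le_card this
  have hQS : #(insert 0 (P a) + S) + #(cls b) ≤ p := by
    refine le_of_le_of_eq ?_ (hcompl (cls b))
    refine Nat.add_le_add_right (card_le_card fun x hx => ?_) _
    obtain ⟨d, hd, u, hu, rfl⟩ := mem_add.1 hx
    have := hP hd u
    rw [add_comm u d] at this
    simp only [hSdef, hcls, mem_compl, mem_filter, mem_univ, true_and] at hu ⊢
    grind
  have hap := hpos a
  have hPa := hPle a
  obtain ⟨d, hd, hdS⟩ := exists_card_add_pair_le (Q := insert 0 (P a)) hS2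
    ⟨by rw [hcardQ]; omega, by rw [hcardQ]; omega, by rw [hcardQ]; omega⟩
  have hmemS : ∀ u, u ∈ S ↔ c u ≠ a ∧ c u ≠ b := fun u => by simp [hSdef]
  have hclslt : ∀ i, #(cls i) < p := fun i => by
    obtain ⟨j, hj⟩ := exists_ne i
    have := hlt2 i j hj.symm
    omega
  have hexit : ∀ i, ∃ u, c u = i ∧ c (u + d) ≠ i := fun i => by
    simpa [hcls] using exists_mem_add_notMem (card_pos.1 (hpos i)) (hclslt i) hd
  have hentry : ∀ i, ∃ u, c u ≠ i ∧ c (u + d) = i := fun i => by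
    obtain ⟨u, hu, hu'⟩ := exists_mem_add_notMem (card_pos.1 (hpos i)) (hclslt i) (neg_ne_zero.2 hd)
    exact ⟨u + -d, by simpa [hcls] using hu', by simpa [hcls] using hu⟩
  have hdom := hX d hd
  -- If the dominant color is outside `S`, classes `e` and `f` each exit `S`; if inside, classes `a`
  -- and `b` are each entered from `S`. Either way there are two exits.
  by_cases hXS : X d = a ∨ X d = b
  · obtain ⟨u, hu, hu'⟩ := hexit e
    obtain ⟨v, hv, hv'⟩ := hexit f
    have h1 := hdom u
    have h2 := hdom v
    have : u = v := eq_of_card_add_pair_le hdS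
      ((hmemS _).2 (by grind)) ((hmemS _).2 (by grind)) (by rw [hmemS]; grind) (by rw [hmemS]; grind)
    grind
  · obtain ⟨u, hu, hu'⟩ := hentry a
    obtain ⟨v, hv, hv'⟩ := hentry b
    have h1 := hdom u
    have h2 := hdom v
    have : u = v := eq_of_card_add_pair_le hdS
      ((hmemS _).2 (by grind)) ((hmemS _).2 (by grind)) (by rw [hmemS]; grind) (by rw [hmemS]; grind)
    grind

end FourColors

/-! ### The quadratic residue coloring -/

/-- Zero, the nonzero squares and the nonsquares of `F`, as three color classes. -/
noncomputable def squareColoring (F : Type*) [Field F] : F → Fin 3 := by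
  classical exact fun x => if x = 0 then 0 else if IsSquare x then 1 else 2

lemma squareColoring_zero (F : Type*) [Field F] : squareColoring F 0 = 0 := by
  simp [squareColoring]

lemma squareColoring_mul_left {F : Type*} [Field F] {s : F} (hs : IsSquare s) (hs0 : s ≠ 0)
    (x : F) : squareColoring F (s * x) = squareColoring F x := by
  have : IsSquare (s * x) ↔ IsSquare x :=
    ⟨fun h => by simpa [hs0] using h.div hs, fun h => hs.mul h⟩
  by_cases h0 : x = 0
  · simp [h0]
  · by_cases hx : IsSquare x <;> simp [squareColoring, hs0, this, h0, hx]

/-- A rainbow progression must contain 0; its other two terms then differ by a factor 2 or -1, a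
square. -/
lemma rainbowFree_squareColoring {F : Type*} [Field F] (h2 : IsSquare (2 : F)) (h20 : (2 : F) ≠ 0)
    (hneg : IsSquare (-1 : F)) : RainbowFree (squareColoring F) := by
  have hn := fun x : F => squareColoring_mul_left hneg (neg_ne_zero.2 one_ne_zero) x
  have hd := fun x : F => squareColoring_mul_left h2 h20 x
  have hz := squareColoring_zero F
  have hne : ∀ x : F, x ≠ 0 → squareColoring F x = 1 ∨ squareColoring F x = 2 := by
    intro x hx
    by_cases h : IsSquare x <;> simp [squareColoring, hx, h]
  intro a d
  by_cases h0 : a = 0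
  · subst h0
    rw [zero_add, ← two_mul, hd]
    simp
  by_cases h1 : a + d = 0
  · have h := hn a
    rw [show -1 * a = a + d + d by linear_combination -2 * h1] at h
    exact Or.inr (Or.inr h.symm)
  by_cases h3 : a + d + d = 0
  · have h := hn a
    have h' := hd (a + d)
    rw [show 2 * (a + d) = a by linear_combination h3] at h'
    exact Or.inl h'
  have := hne _ h0
  have := hne _ h1
  have := hne _ h3
  grind

lemma squareColoring_surjective {F : Type*} [Field F] [Finite F] (hF : ringChar F ≠ 2) :
    Function.Surjective (squareColoring F) := by
  intro i
  fin_cases i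
  · exact ⟨0, squareColoring_zero F⟩
  · exact ⟨1, by simp [squareColoring]⟩
  · obtain ⟨a, ha⟩ := FiniteField.exists_nonsquare hF
    have h0 : a ≠ 0 := by rintro rfl; simp at ha
    exact ⟨a, by simp [squareColoring, ha, h0]⟩

/-! ### The anti-van der Waerden number -/

lemma hasRainbowAP_univ_three_iff {G : Type*} [AddCommGroup G] {r : ℕ} {c : G → Fin r} :
    HasRainbowAP (Set.univ : Set G) 3 (fun x => c x) ↔ ¬ RainbowFree c := by
  constructor
  · rintro ⟨t, ⟨-, a, d, ht⟩, hinj⟩ hc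
    have h0 := ht 0
    have h1 := ht 1
    have h2 := ht 2
    simp only [Fin.val_zero, Fin.val_one, Fin.val_two, zero_smul, one_smul, two_smul, add_zero,
      ← add_assoc] at h0 h1 h2
    have := hc a d
    rw [← h2, ← h1, ← h0] at this
    rcases this with h | h | h
    · exact absurd (hinj h) (by decide)
    · exact absurd (hinj h) (by decide)
    · exact absurd (hinj h) (by decide)
  · intro h
    simp only [RainbowFree, not_forall, not_or] at h
    obtain ⟨a, d, h1, h2, h3⟩ := h
    have hinj : Function.Injective (fun i : Fin 3 => c (a + (i : ℕ) • d)) := by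
      intro i j hij
      fin_cases i <;> fin_cases j <;> simp [two_smul, ← add_assoc] at hij ⊢ <;>
        first
        | exact h1 hij
        | exact h2 hij
        | exact h3 hij
        | exact h1 hij.symm
        | exact h2 hij.symm
        | exact h3 hij.symm
    refine ⟨fun i => ⟨a + (i : ℕ) • d, trivial⟩, ⟨fun i j hij => hinj ?_, a, d, fun _ => rfl⟩, hinj⟩
    exact congrArg c (congrArg Subtype.val hij)

lemma RainbowFree.comp {G K L : Type*} [AddCommGroup G] {c : G → K} (hc : RainbowFree c)
    (g : K → L) : RainbowFree (g ∘ c) := fun a d =>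
  (hc a d).imp (congrArg g) (Or.imp (congrArg g) (congrArg g))

theorem antiVdW_zmod_three_eq_four {p : ℕ} (hp : p.Prime) (h8 : p ≡ 1 [MOD 8]) :
    antiVdW (Set.univ : Set (ZMod p)) 3 = 4 := by
  have : Fact p.Prime := ⟨hp⟩
  have h8' : p % 8 = 1 := h8
  have hp4 : 4 < p := by have := hp.two_le; omega
  refine IsLeast.csInf_eq ⟨⟨by norm_num, fun c hc => ?_⟩, fun r ⟨hr, h⟩ => ?_⟩
  · have hs : Function.Surjective (fun x : ZMod p => c ⟨x, trivial⟩) := fun i => by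
      obtain ⟨x, hx⟩ := hc i
      exact ⟨x, hx⟩
    exact hasRainbowAP_univ_three_iff.2 (not_rainbowFree_of_surjective_four hs hp4)
  · by_contra! hr4
    have : NeZero r := ⟨by omega⟩
    have h20 : (2 : ZMod p) ≠ 0 := by
      intro h
      have := (ZMod.natCast_eq_zero_iff 2 p).1 (by exact_mod_cast h)
      have := Nat.le_of_dvd (by norm_num) this
      omega
    have hfree := rainbowFree_squareColoring (F := ZMod p)
      ((ZMod.exists_sq_eq_two_iff (by omega)).2 (Or.inl h8')) h20
      (ZMod.exists_sq_eq_neg_one_iff.2 (by omega))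
    have hsurj := squareColoring_surjective (F := ZMod p) (by rw [ZMod.ringChar_zmod_n]; omega)
    have hg : Function.Surjective (fun i : Fin 3 => Fin.ofNat r i) := fun j =>
      ⟨⟨j, by omega⟩, by ext; simp⟩
    refine hasRainbowAP_univ_three_iff.1
      (h (fun x => ((fun i : Fin 3 => Fin.ofNat r i) ∘ squareColoring (ZMod p)) x) fun j => ?_)
      (hfree.comp _)
    obtain ⟨x, hx⟩ := (hg.comp hsurj) j
    exact ⟨⟨x, trivial⟩, hx⟩

theorem mainTheorem5 :
    (∀ p : ℕ, p.Prime → p ≡ 1 [MOD 8] → antiVdW (Set.univ : Set (ZMod p)) 3 = 4) ∧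
    {p : ℕ | p.Prime ∧ p ≡ 1 [MOD 8]}.Infinite ∧
    {p : ℕ | p.Prime ∧ antiVdW (Set.univ : Set (ZMod p)) 3 = 4}.Infinite := by
  have hinf : {p : ℕ | p.Prime ∧ p ≡ 1 [MOD 8]}.Infinite :=
    Nat.infinite_setOfPred_prime_modEq_one (by norm_num)
  exact ⟨fun p hp h8 => antiVdW_zmod_three_eq_four hp h8, hinf,
    hinf.mono fun p h => ⟨h.1, antiVdW_zmod_three_eq_four h.1 h.2⟩⟩
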